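/- Let $p$ be a prime. For $n\ge 0$ let $$L_n^{(\alpha)}(X)=\sum_{k=0}^{n}\binom{\alpha+n}{n-k}\frac{(-X)^k}{k!}$$ be the generalized Laguerre polynomial, where $\binom{a}{m}=a(a-1)\cdots(a-m+1)/m!$; for $n=p-1$ its coefficients, as a polynomial in $\alpha$ and $X$, have denominators prime to $p$, so it may be read over $\mathbb F_p$. Put $$S(X)=L_{p-1}^{\left(-\sum_{i=1}^{\infty}X^{p^i}\right)}(X)\in\mathbb F_p[[X]],$$ and let $E_p(X)=\exp\Bigl(\sum_{i=0}^{\infty}X^{p^i}/p^i\Bigr)\in\mathbb Q[[X]]$ be the Artin–Hasse exponential. Then the coefficients of $E_p(X)$ have denominators prime to $p$, and, viewing $E_p(X)$ modulo $p$ as an element of $\mathbb F_p[[X]]$, there is a power series $G(X)\in 1+X\,\mathbb F_p[[X]]$ such that $$S(X)=E_p(X)\cdot G(X^p)\quad\text{in } \mathbb F_p[[X]].$$ -/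

import Mathlib

open scoped Nat

noncomputable section

/-- The logarithm `∑_{i ≥ 0} X^(p^i) / p^i` of the Artin–Hasse exponential, for `p` prime:
the coefficient of `X^n` is `1 / n` if `n` is a power of `p`, and `0` otherwise. -/
def artinHasseLog (p : ℕ) : PowerSeries ℚ :=
  open Classical in PowerSeries.mk fun n => if ∃ i : ℕ, n = p ^ i then 1 / (n : ℚ) else 0

/-- The Artin–Hasse exponential `E_p(X) = exp(∑_{i ≥ 0} X^(p^i) / p^i)` in `ℚ⟦X⟧`. -/
def artinHasseExp (p : ℕ) : PowerSeries ℚ :=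
  (PowerSeries.exp ℚ).subst (artinHasseLog p)

/-- The substitution in the definition of `artinHasseExp` is a legitimate one. -/
theorem hasSubst_artinHasseLog (p : ℕ) [Fact p.Prime] :
    PowerSeries.HasSubst (artinHasseLog p) := by
  apply PowerSeries.HasSubst.of_constantCoeff_zero'
  have h : (PowerSeries.coeff 0) (artinHasseLog p) = 0 := by
    simp [artinHasseLog, PowerSeries.coeff_mk]
  simpa using h

/-- Reduction modulo `p`, coefficient by coefficient, of a power series with rational coefficients;
it is meaningful for series whose coefficients have denominators prime to `p`. -/
def reduceMod (p : ℕ) [Fact p.Prime] (f : PowerSeries ℚ) : PowerSeries (ZMod p) :=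
  PowerSeries.mk fun n =>
    ((PowerSeries.coeff n f).num : ZMod p) / ((PowerSeries.coeff n f).den : ZMod p)

/-- The binomial coefficient `a (a - 1) ⋯ (a - m + 1) / m!` of an element `a` of an algebra over
a field `K` in which `m!` is nonzero. -/
def genBinom (K : Type*) {A : Type*} [Field K] [CommRing A] [Algebra K A] (a : A) (m : ℕ) : A :=
  ((m ! : ℕ) : K)⁻¹ • ∏ j ∈ Finset.range m, (a - (j : A))

/-- The generalized Laguerre polynomial
`L_n^{(α)}(x) = ∑_{k=0}^n binom(α + n, n - k) (-x)^k / k!`, evaluated at elements `α`, `x`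
of a commutative algebra over a field `K` in which `n!` is nonzero. -/
def laguerre (K : Type*) {A : Type*} [Field K] [CommRing A] [Algebra K A]
    (n : ℕ) (α x : A) : A :=
  ∑ k ∈ Finset.range (n + 1),
    genBinom K (α + (n : A)) (n - k) * (((k ! : ℕ) : K)⁻¹ • (-x) ^ k)

/-- The power series `∑_{i ≥ 1} X^(p^i)` over `𝔽_p`, for `p` prime. -/
def frobeniusSum (p : ℕ) : PowerSeries (ZMod p) :=
  open Classical in PowerSeries.mk fun n => if ∃ i : ℕ, 1 ≤ i ∧ n = p ^ i then 1 else 0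

/-- The power series `S(X) = L_{p-1}^{(-∑_{i ≥ 1} X^(p^i))}(X)` in `𝔽_p⟦X⟧`. -/
def laguerreSeries (p : ℕ) [Fact p.Prime] : PowerSeries (ZMod p) :=
  laguerre (ZMod p) (p - 1) (-frobeniusSum p) PowerSeries.X

end

/-!
The series `S` and `E_p` modulo `p` satisfy the same first-order linear differential equation
`y' = (∑_{i ≥ 0} X^(p^i - 1)) y` over `𝔽_p`. Hence `S / E_p` has derivative zero, and over `𝔽_p` a
power series with zero derivative is a power series in `X^p`; its constant term is `1` because
`S(0) = E_p(0) = 1`.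

For `E_p` the equation holds over `ℚ` by the chain rule, and it descends to `𝔽_p` once `E_p` is known
to be `p`-integral. That comes from Dwork's criterion
(`coeff_mem_pIntegral_of_pow_eq_expand_mul`) applied to the functional equation
`E_p(X)^p = E_p(X^p) exp(pX)` (`artinHasseExp_pow`), since `exp(pX) - 1` is divisible by `p`
over `ℤ_(p)`.

For `S`, comparing consecutive terms shows that `L = L_{p-1}^{(α)}` satisfies
`X L' = (X - α) L + X^p + α - α^p` in characteristic `p` whenever `α` has derivative zero
(`X_mul_derivative_laguerre`); the boundary terms are evaluated with Wilson's theorem and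
`∏_{j < p} (α - j) = α^p - α`. For `α = -∑_{i ≥ 1} X^(p^i)` one has `α^p - α = X^p`, so the
inhomogeneous part vanishes, and `X - α = ∑_{i ≥ 0} X^(p^i)`.
-/

open PowerSeries

/-! ### Rational numbers with denominator prime to `p` -/

/-- The ring `ℤ_(p)` of rational numbers with denominator prime to `p`. -/
def pIntegral (p : ℕ) [Fact p.Prime] : Subring ℚ where
  carrier := {q | (q.den : ZMod p) ≠ 0}
  zero_mem' := by simp
  one_mem' := by simp
  add_mem' {a b} ha hb := by
    intro h
    have h1 := (ZMod.natCast_eq_zero_iff _ _).1 h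
    have h2 := (ZMod.natCast_eq_zero_iff _ _).2 (h1.trans (Rat.add_den_dvd a b))
    rw [Nat.cast_mul] at h2
    exact (mul_ne_zero ha hb) h2
  mul_mem' {a b} ha hb := by
    intro h
    have h1 := (ZMod.natCast_eq_zero_iff _ _).1 h
    have h2 := (ZMod.natCast_eq_zero_iff _ _).2 (h1.trans (Rat.mul_den_dvd a b))
    rw [Nat.cast_mul] at h2
    exact (mul_ne_zero ha hb) h2
  neg_mem' {a} ha := by simpa using ha

section

variable {p : ℕ} [Fact p.Prime]

theorem mem_pIntegral {q : ℚ} : q ∈ pIntegral p ↔ (q.den : ZMod p) ≠ 0 := Iff.rfl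

theorem mem_pIntegral_iff_not_dvd {q : ℚ} : q ∈ pIntegral p ↔ ¬ p ∣ q.den := by
  rw [mem_pIntegral, Ne, ZMod.natCast_eq_zero_iff]

theorem div_mem_pIntegral (a : ℤ) {b : ℕ} (hb : ¬ p ∣ b) : (a / b : ℚ) ∈ pIntegral p := by
  rw [mem_pIntegral_iff_not_dvd]
  intro h
  have h1 := Rat.den_dvd a b
  rw [Rat.divInt_eq_div, Int.cast_natCast] at h1
  exact hb (h.trans (Int.natCast_dvd_natCast.1 h1))

variable (p) in
/-- Reduction modulo `p` from `ℤ_(p)` to `𝔽_p`, sending `a / b` to `a * b⁻¹`. -/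
def residueMap : pIntegral p →+* ZMod p where
  toFun q := ((q : ℚ) : ZMod p)
  map_zero' := by simp
  map_one' := by simp
  map_add' a b := Rat.cast_add_of_ne_zero a.2 b.2
  map_mul' a b := Rat.cast_mul_of_ne_zero a.2 b.2

theorem residueMap_apply (q : pIntegral p) : residueMap p q = ((q : ℚ) : ZMod p) := rfl

theorem dvd_of_residueMap_eq_zero {q : pIntegral p} (h : residueMap p q = 0) :
    (p : pIntegral p) ∣ q := by
  have hq := q.2
  rw [residueMap_apply, Rat.cast_def, div_eq_zero_iff, or_iff_left q.2,
    ZMod.intCast_zmod_eq_zero_iff_dvd] at h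
  obtain ⟨k, hk⟩ := h
  refine ⟨⟨_, div_mem_pIntegral k (mem_pIntegral_iff_not_dvd.1 hq)⟩, Subtype.ext ?_⟩
  push_cast
  rw [← mul_div_assoc, ← Int.cast_natCast p, ← Int.cast_mul, ← hk, Rat.num_div_den]

/-- The coefficients of `(exp(pX) - 1) / p` are `p`-integral, because `v_p((n + 1)!) ≤ n`. -/
theorem pow_div_factorial_mem_pIntegral (n : ℕ) :
    ((p : ℚ) ^ n / ((n + 1)! : ℕ)) ∈ pIntegral p := by
  have hp : p.Prime := Fact.out
  obtain ⟨m, hm⟩ := pow_padicValNat_dvd (p := p) (n := (n + 1)!)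
  generalize hv : padicValNat p (n + 1)! = v at hm
  have hvn : v ≤ n := hv ▸ Nat.le_of_lt_succ (padicValNat_factorial_lt_of_ne_zero p n.succ_ne_zero)
  have hpm : ¬ p ∣ m := by
    rintro ⟨k, rfl⟩
    refine pow_succ_padicValNat_not_dvd (p := p) (Nat.factorial_ne_zero (n + 1)) ⟨k, ?_⟩
    rw [hv, hm]; ring
  have h := div_mem_pIntegral (p := p) ((p : ℤ) ^ (n - v)) hpm
  have hp0 : (p : ℚ) ≠ 0 := by exact_mod_cast hp.ne_zero
  convert h using 1
  have hm' : ((n + 1)! : ℚ) = (p : ℚ) ^ v * m := by exact_mod_cast hm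
  rw [hm', ← Nat.sub_add_cancel hvn, pow_add, mul_comm (_ ^ (n - v)),
    mul_div_mul_left _ _ (pow_ne_zero _ hp0)]
  simp

end

/-! ### Power series: Frobenius, derivatives, and a `p`-integrality criterion -/

section

variable {p : ℕ} [Fact p.Prime]

theorem natCast_self_eq_zero : (p : (ZMod p)⟦X⟧) = 0 := by
  rw [← map_natCast (C (R := ZMod p)), CharP.cast_eq_zero, map_zero]

/-- Over `𝔽_p`, substituting `X ^ p` is the same as raising to the `p`-th power. -/
theorem expand_card_eq_pow (hp : p ≠ 0) (f : (ZMod p)⟦X⟧) : f.expand p hp = f ^ p := by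
  have h := MvPowerSeries.map_frobenius_expand p hp (f := f)
  rw [ZMod.frobenius_zmod] at h
  rw [← h]
  simp [PowerSeries.expand]

end

section
variable {R S : Type*} [CommRing R] [CommRing S]

theorem map_derivative (F : R →+* S) (f : R⟦X⟧) :
    (d⁄dX R f).map F = d⁄dX S (f.map F) := by
  ext n
  simp [coeff_derivative]

theorem derivative_expand (p : ℕ) (hp : p ≠ 0) (f : R⟦X⟧) :
    d⁄dX R (f.expand p hp) = (p : R⟦X⟧) * X ^ (p - 1) * (d⁄dX R f).expand p hp := by
  rw [expand_apply, derivative_subst (HasSubst.X_pow hp), derivative_pow, derivative_X,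
    expand_apply, mul_one, mul_comm]

/-- The `n`-th coefficient of a product depends only on the coefficients up to the `n`-th. -/
theorem coeff_mul_congr {n : ℕ} {f g : R⟦X⟧} (h : ∀ m ≤ n, coeff m f = coeff m g) (u : R⟦X⟧) :
    coeff n (f * u) = coeff n (g * u) := by
  rw [coeff_mul, coeff_mul]
  refine Finset.sum_congr rfl fun x hx => ?_
  rw [h _ (le_of_le_of_eq (Nat.le_add_right _ _) (Finset.HasAntidiagonal.mem_antidiagonal.1 hx))]

/-- A solution of `y' = u y` in characteristic zero is determined by its constant term. -/
theorem eq_of_derivative_eq_mul {K : Type*} [Field K] [CharZero K] {f g u : K⟦X⟧}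
    (hf : d⁄dX K f = u * f) (hg : d⁄dX K g = u * g) (hc : constantCoeff f = constantCoeff g)
    (hg0 : constantCoeff g ≠ 0) : f = g := by
  have h : f * g⁻¹ = 1 := by
    refine derivative.ext ?_ ?_
    · rw [Derivation.leibniz, derivative_inv', hf, hg, derivative_one]
      simp only [smul_eq_mul]
      linear_combination (-f * u * g⁻¹) * PowerSeries.mul_inv_cancel g hg0
    · simp [hc, hg0]
  rw [← mul_one f, ← PowerSeries.inv_mul_cancel g hg0, ← mul_assoc, h, one_mul]
end

section
variable {p : ℕ} [Fact p.Prime]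

/-- Dwork's criterion: if `f(X)^p / f(X^p)` has the form `1 + p v(X)` with `v` a `p`-integral series,
then `f` is `p`-integral. By induction on `n`: writing `f = G + X^n t` with `G` the `p`-integral
truncation below degree `n`, the coefficient of `X^n` in `f^p` is that of `G^p` plus `p` times that
of `f`, while `G^p` and `G(X^p)` agree modulo `p`. -/
theorem coeff_mem_pIntegral_of_pow_eq_expand_mul (hp : p ≠ 0) {f : ℚ⟦X⟧}
    (hf : constantCoeff f = 1) (v : (pIntegral p)⟦X⟧)
    (h : f ^ p = f.expand p hp * (1 + (p : ℚ⟦X⟧) * v.map (pIntegral p).subtype)) (n : ℕ) :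
    coeff n f ∈ pIntegral p := by
  induction n using Nat.strong_induction_on with | _ n ih
  obtain rfl | hn := Nat.eq_zero_or_pos n
  · rw [coeff_zero_eq_constantCoeff, hf]
    exact one_mem _
  let g : (pIntegral p)⟦X⟧ := mk fun m => if hm : m < n then ⟨coeff m f, ih m hm⟩ else 0
  let t : ℚ⟦X⟧ := mk fun m => coeff (m + n) f
  set G : ℚ⟦X⟧ := g.map (pIntegral p).subtype with hG
  have hGc (m : ℕ) : coeff m G = if m < n then coeff m f else 0 := by
    rw [hG, coeff_map, coeff_mk]
    split_ifs <;> simp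
  have hG0 : constantCoeff G = 1 := by
    rw [← coeff_zero_eq_constantCoeff_apply, hGc, if_pos hn, coeff_zero_eq_constantCoeff, hf]
  have hsplit : f = G + X ^ n * t := by
    ext m
    rw [map_add, hGc, coeff_X_pow_mul']
    split_ifs with h1 h2 h2
    · omega
    · simp
    · simp [t, Nat.sub_add_cancel h2]
    · omega
  have hpow : coeff n (f ^ p) = coeff n (G ^ p) + p * coeff n f := by
    obtain ⟨k, hk⟩ := Polynomial.powAddExpansion G (X ^ n * t) p
    have e : (p : ℚ⟦X⟧) * G ^ (p - 1) * (X ^ n * t) + k * (X ^ n * t) ^ 2 =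
        X ^ n * (C (p : ℚ) * (G ^ (p - 1) * t) + X ^ n * (k * t ^ 2)) := by
      rw [map_natCast]; ring
    have hXn : constantCoeff (X ^ n : ℚ⟦X⟧) = 0 := by simp [hn.ne']
    have ht : constantCoeff t = coeff n f := by
      rw [← coeff_zero_eq_constantCoeff_apply, coeff_mk, zero_add]
    conv_lhs => rw [hsplit, hk, add_assoc, e, map_add, coeff_X_pow_mul', if_pos le_rfl,
      Nat.sub_self, coeff_zero_eq_constantCoeff]
    rw [map_add, map_mul _ (X ^ n), hXn]
    simp [hG0, ht]
  -- In degrees up to `n`, `f(X^p)` involves only coefficients of `f` of degree below `n`.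
  have hexp (m : ℕ) (hm : m ≤ n) : coeff m (f.expand p hp) = coeff m (G.expand p hp) := by
    rw [coeff_expand, coeff_expand]
    split_ifs with hd
    · rw [hGc, if_pos]
      exact (Nat.div_le_div_right hm).trans_lt
        (Nat.div_lt_self hn (Fact.out : p.Prime).one_lt)
    · rfl
  set r : pIntegral p := coeff n (g.expand p hp * (1 + (p : (pIntegral p)⟦X⟧) * v) - g ^ p)
    with hr
  have hrf : (r : ℚ) = p * coeff n f := by
    have h1 : (pIntegral p).subtype r = coeff n (f ^ p) - coeff n (G ^ p) := by
      rw [h, coeff_mul_congr hexp, hr, ← coeff_map]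
      simp [hG]
    rw [hpow, add_sub_cancel_left] at h1
    exact h1
  -- Modulo `p`, both `g(X^p)` and `g^p` are the same series.
  have hr0 : residueMap p r = 0 := by
    rw [hr, ← coeff_map]
    simp [expand_card_eq_pow, natCast_self_eq_zero]
  obtain ⟨s, hs⟩ := dvd_of_residueMap_eq_zero hr0
  have hs' : (p : ℚ) * s = p * coeff n f := by
    rw [← hrf, hs]; push_cast; rfl
  rw [← mul_left_cancel₀ (by exact_mod_cast hp) hs']
  exact s.2

end

/-! ### The Artin–Hasse exponential -/

section ArtinHasse

open Classical in
/-- The series `∑_{i ≥ 0} X^(p^i - 1)`, which is the derivative of `∑_{i ≥ 0} X^(p^i) / p^i`;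
its coefficients being integers, it makes sense over every ring. -/
noncomputable def artinHasseLogDeriv (R : Type*) [CommRing R] (p : ℕ) : R⟦X⟧ :=
  mk fun n => if ∃ i : ℕ, n + 1 = p ^ i then 1 else 0

theorem map_artinHasseLogDeriv {R S : Type*} [CommRing R] [CommRing S] (F : R →+* S) (p : ℕ) :
    (artinHasseLogDeriv R p).map F = artinHasseLogDeriv S p := by
  ext n
  simp only [artinHasseLogDeriv, coeff_map, coeff_mk]
  split_ifs <;> simp

theorem derivative_artinHasseLog (p : ℕ) :
    d⁄dX ℚ (artinHasseLog p) = artinHasseLogDeriv ℚ p := by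
  ext n
  rw [coeff_derivative, artinHasseLog, artinHasseLogDeriv, coeff_mk, coeff_mk]
  split_ifs
  · push_cast
    exact one_div_mul_cancel (by positivity)
  · simp

theorem constantCoeff_artinHasseLog (p : ℕ) : constantCoeff (artinHasseLog p) = 0 := by
  rw [← coeff_zero_eq_constantCoeff_apply]
  simp [artinHasseLog]

variable {p : ℕ} [Fact p.Prime]

theorem exists_add_eq_pow_iff {n : ℕ} (hn : n + 1 ≠ 1) :
    (∃ i, n + 1 = p ^ i) ↔ p ∣ n + 1 ∧ ∃ i, (n + 1) / p = p ^ i := by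
  have hp : 0 < p := (Fact.out : p.Prime).pos
  constructor
  · rintro ⟨i, hi⟩
    obtain _ | i := i
    · simp_all
    · rw [hi, pow_succ]
      exact ⟨dvd_mul_left _ _, i, Nat.mul_div_cancel _ hp⟩
  · rintro ⟨hd, i, hi⟩
    exact ⟨i + 1, by rw [pow_succ, ← hi, Nat.div_mul_cancel hd]⟩

/-- Writing `ℓ` for `∑ X^(p^i) / p^i`, this is the derivative of `ℓ(X) = X + ℓ(X^p) / p`. -/
theorem artinHasseLogDeriv_eq (R : Type*) [CommRing R] (hp : p ≠ 0) :
    artinHasseLogDeriv R p = 1 + X ^ (p - 1) * (artinHasseLogDeriv R p).expand p hp := by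
  have hp2 := (Fact.out : p.Prime).two_le
  ext n
  rw [map_add, coeff_X_pow_mul', coeff_one]
  obtain rfl | hn := eq_or_ne n 0
  · have h0 : ∃ i, 0 + 1 = p ^ i := ⟨0, by simp⟩
    have hp0 : ¬ p - 1 ≤ 0 := by omega
    rw [if_neg hp0, artinHasseLogDeriv, coeff_mk, if_pos h0]
    simp
  rw [if_neg hn, zero_add, coeff_expand]
  simp only [artinHasseLogDeriv, coeff_mk]
  rw [exists_add_eq_pow_iff (by omega)]
  by_cases hd : p ∣ n + 1
  · have hle : p ≤ n + 1 := Nat.le_of_dvd n.succ_pos hd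
    have e1 : n - (p - 1) = n + 1 - p := by omega
    have e2 : (n + 1 - p) / p + 1 = (n + 1) / p := by
      rw [← Nat.add_div_right _ (by omega), Nat.sub_add_cancel hle]
    rw [if_pos (show p - 1 ≤ n by omega), e1, if_pos (Nat.dvd_sub hd dvd_rfl), e2]
    congr 1
    exact propext (and_iff_right hd)
  · rw [if_neg (by tauto)]
    split_ifs with h1 h2
    · exfalso
      apply hd
      have := Nat.dvd_add h2 (dvd_refl p)
      rwa [show n - (p - 1) + p = n + 1 by omega] at this
    all_goals rfl

theorem constantCoeff_artinHasseExp : constantCoeff (artinHasseExp p) = 1 := by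
  have h := hasSubst_artinHasseLog p
  have e : artinHasseExp p = (exp ℚ - 1).subst (artinHasseLog p) + 1 := by
    rw [artinHasseExp, ← coe_substAlgHom h, map_sub, map_one, sub_add_cancel]
  have h0 := constantCoeff_subst_eq_zero (a := artinHasseLog p)
    (constantCoeff_artinHasseLog p) (exp ℚ - 1) (by simp)
  rw [e, map_add, map_one]
  exact (congrArg (· + 1) h0).trans (zero_add 1)

theorem derivative_artinHasseExp :
    d⁄dX ℚ (artinHasseExp p) = artinHasseLogDeriv ℚ p * artinHasseExp p := by
  rw [artinHasseExp, derivative_subst (hasSubst_artinHasseLog p), derivative_exp,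
    derivative_artinHasseLog, mul_comm]

theorem derivative_rescale_exp (a : ℚ) :
    d⁄dX ℚ (rescale a (exp ℚ)) = C a * rescale a (exp ℚ) := by
  ext n
  have h := congrArg (coeff n) (derivative_exp ℚ)
  rw [coeff_derivative] at h
  rw [coeff_derivative, coeff_rescale, coeff_C_mul, coeff_rescale, ← h]
  ring

/-- The functional equation `E_p(X)^p = E_p(X^p) exp(pX)`: both sides have logarithmic derivative
`p ∑ X^(p^i - 1)`. -/
theorem artinHasseExp_pow (hp : p ≠ 0) :
    artinHasseExp p ^ p = (artinHasseExp p).expand p hp * rescale (p : ℚ) (exp ℚ) := by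
  have h0 : constantCoeff ((artinHasseExp p).expand p hp * rescale (p : ℚ) (exp ℚ)) = 1 := by
    rw [map_mul, constantCoeff_expand, constantCoeff_artinHasseExp,
      ← coeff_zero_eq_constantCoeff_apply (rescale _ _), coeff_rescale]
    simp
  refine eq_of_derivative_eq_mul (u := (p : ℚ⟦X⟧) * artinHasseLogDeriv ℚ p) ?_ ?_ ?_ ?_
  · rw [derivative_pow, derivative_artinHasseExp]
    rw [← mul_pow_sub_one hp (artinHasseExp p)]
    ring
  · rw [Derivation.leibniz, derivative_rescale_exp, derivative_expand, derivative_artinHasseExp,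
      map_mul, map_natCast]
    conv_rhs => rw [artinHasseLogDeriv_eq ℚ hp]
    simp only [smul_eq_mul]
    ring
  · rw [h0, map_pow, constantCoeff_artinHasseExp, one_pow]
  · rw [h0]
    exact one_ne_zero

theorem coeff_artinHasseExp_mem_pIntegral (n : ℕ) :
    coeff n (artinHasseExp p) ∈ pIntegral p := by
  have hp : p ≠ 0 := (Fact.out : p.Prime).ne_zero
  let v : (pIntegral p)⟦X⟧ :=
    X * mk fun k => ⟨(p : ℚ) ^ k / ((k + 1)! : ℕ), pow_div_factorial_mem_pIntegral k⟩
  refine coeff_mem_pIntegral_of_pow_eq_expand_mul hp constantCoeff_artinHasseExp v ?_ n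
  rw [artinHasseExp_pow hp]
  congr 1
  ext k
  rw [coeff_rescale, ← map_natCast (C (R := ℚ)), map_add, coeff_C_mul, map_mul, map_X]
  obtain _ | k := k
  · simp
  · rw [coeff_succ_X_mul, coeff_map, coeff_mk, coeff_one]
    simp [pow_succ]
    ring

variable (p) in
/-- The Artin–Hasse exponential as a power series over `ℤ_(p)`. -/
noncomputable def integralArtinHasseExp : (pIntegral p)⟦X⟧ :=
  mk fun n => ⟨coeff n (artinHasseExp p), coeff_artinHasseExp_mem_pIntegral n⟩

theorem map_subtype_integralArtinHasseExp :
    (integralArtinHasseExp p).map (pIntegral p).subtype = artinHasseExp p := by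
  ext n
  simp [integralArtinHasseExp]

theorem reduceMod_artinHasseExp :
    reduceMod p (artinHasseExp p) = (integralArtinHasseExp p).map (residueMap p) := by
  ext n
  rw [reduceMod, coeff_mk, coeff_map, integralArtinHasseExp, coeff_mk, residueMap_apply,
    Rat.cast_def]

theorem constantCoeff_reduceMod_artinHasseExp :
    constantCoeff (reduceMod p (artinHasseExp p)) = 1 := by
  rw [← coeff_zero_eq_constantCoeff_apply, reduceMod, coeff_mk, coeff_zero_eq_constantCoeff,
    constantCoeff_artinHasseExp]
  simp

/-- The differential equation of `E_p` descends to `𝔽_p`, since it already holds over `ℤ_(p)`. -/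
theorem derivative_reduceMod_artinHasseExp :
    d⁄dX (ZMod p) (reduceMod p (artinHasseExp p)) =
      artinHasseLogDeriv (ZMod p) p * reduceMod p (artinHasseExp p) := by
  have h : d⁄dX _ (integralArtinHasseExp p) =
      artinHasseLogDeriv _ p * integralArtinHasseExp p := by
    apply map_injective (pIntegral p).subtype Subtype.val_injective
    rw [map_derivative, map_mul, map_artinHasseLogDeriv, map_subtype_integralArtinHasseExp,
      derivative_artinHasseExp]
  rw [reduceMod_artinHasseExp, ← map_derivative, h, map_mul, map_artinHasseLogDeriv]

end ArtinHasse

/-! ### The Laguerre polynomial of degree `p - 1` in characteristic `p` -/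

section Laguerre

variable {p : ℕ} [Fact p.Prime]

theorem prod_range_sub_natCast (p : ℕ) [Fact p.Prime] {A : Type*} [CommRing A]
    [Algebra (ZMod p) A] (a : A) : ∏ j ∈ Finset.range p, (a - (j : A)) = a ^ p - a := by
  have hp1 : 1 < p := (Fact.out : p.Prime).one_lt
  have h : (Polynomial.X ^ p - Polynomial.X : Polynomial (ZMod p)) =
      ∏ c : ZMod p, (Polynomial.X - Polynomial.C c) := by
    have hr := FiniteField.roots_X_pow_card_sub_X (ZMod p)
    rw [ZMod.card] at hr
    have hd := FiniteField.X_pow_card_sub_X_natDegree_eq (ZMod p) hp1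
    have hm : (Polynomial.X ^ p - Polynomial.X : Polynomial (ZMod p)).Monic :=
      Polynomial.monic_X_pow_sub (by simpa using hp1)
    have := Polynomial.prod_multiset_X_sub_C_of_monic_of_roots_card_eq hm
      (by rw [hr, hd, ← Finset.card_def, Finset.card_univ, ZMod.card])
    rw [hr] at this
    exact this.symm
  have h2 := congrArg (Polynomial.aeval a) h
  rw [map_prod] at h2
  simp only [map_sub, map_pow, Polynomial.aeval_X, Polynomial.aeval_C] at h2
  rw [h2]
  refine Finset.prod_nbij' (fun j => (j : ZMod p)) ZMod.val ?_ ?_ ?_ ?_ ?_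
  · simp
  · intro c _
    simpa using ZMod.val_lt c
  · intro j hj
    exact ZMod.val_cast_of_lt (Finset.mem_range.1 hj)
  · simp
  · simp

variable {A : Type*} [CommRing A] [Algebra (ZMod p) A]

/-- The `k`-th summand of `L_{p-1}^{(α)}(x)`. -/
noncomputable def laguerreTerm (p : ℕ) [Fact p.Prime] [Algebra (ZMod p) A] (α x : A) (k : ℕ) : A :=
  genBinom (ZMod p) (α + ((p - 1 : ℕ) : A)) (p - 1 - k) *
    (((k ! : ℕ) : ZMod p)⁻¹ • (-x) ^ k)

theorem laguerre_eq_sum_laguerreTerm (α x : A) :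
    laguerre (ZMod p) (p - 1) α x = ∑ k ∈ Finset.range p, laguerreTerm p α x k := by
  rw [laguerre, Nat.sub_add_cancel (Fact.out : p.Prime).pos]
  rfl

theorem factorial_ne_zero_zmod {k : ℕ} (hk : k < p) : ((k ! : ℕ) : ZMod p) ≠ 0 := by
  rw [Ne, ZMod.natCast_eq_zero_iff, (Fact.out : p.Prime).dvd_factorial]
  omega

theorem succ_mul_inv_factorial_succ {k : ℕ} (hk : k + 1 < p) :
    ((k + 1 : ℕ) : ZMod p) * (((k + 1)! : ℕ) : ZMod p)⁻¹ = ((k ! : ℕ) : ZMod p)⁻¹ := by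
  have h0 := factorial_ne_zero_zmod hk
  rw [Nat.factorial_succ, Nat.cast_mul] at h0 ⊢
  rw [mul_inv, mul_inv_cancel_left₀ (left_ne_zero_of_mul h0)]

theorem natCast_pred_eq_neg_one : ((p - 1 : ℕ) : A) = -1 := by
  have h : ((p - 1 : ℕ) : ZMod p) = -1 := by
    rw [Nat.cast_sub (Fact.out : p.Prime).pos]
    simp
  simpa using congrArg (algebraMap (ZMod p) A) h

theorem mul_genBinom_succ (a : A) {m : ℕ} (hm : m + 1 < p) :
    ((m + 1 : ℕ) : A) * genBinom (ZMod p) a (m + 1) = genBinom (ZMod p) a m * (a - m) := by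
  rw [genBinom, genBinom, Finset.prod_range_succ, ← map_natCast (algebraMap (ZMod p) A),
    ← Algebra.smul_def, smul_smul, succ_mul_inv_factorial_succ hm, smul_mul_assoc]

theorem mul_inv_factorial_succ (x : A) {k : ℕ} (hk : k + 1 < p) :
    ((k + 1 : ℕ) : A) * ((((k + 1)! : ℕ) : ZMod p)⁻¹ • (-x) ^ (k + 1)) =
      -x * (((k ! : ℕ) : ZMod p)⁻¹ • (-x) ^ k) := by
  rw [← map_natCast (algebraMap (ZMod p) A), ← Algebra.smul_def, smul_smul,
    succ_mul_inv_factorial_succ hk, pow_succ', mul_smul_comm]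

/-- The two-term recursion behind the differential equation: summed over `k`, the left side gives
`x L` and the right side `α L + x L'`, up to the two boundary terms. -/
theorem mul_laguerreTerm (α x : A) {k : ℕ} (hk : k + 1 < p) :
    x * laguerreTerm p α x k = (α + (k + 1 : ℕ)) * laguerreTerm p α x (k + 1) := by
  obtain ⟨m, hm⟩ : ∃ m, p = m + k + 2 := ⟨p - (k + 2), by omega⟩
  have e1 : p - 1 - k = m + 1 := by omega
  have e2 : p - 1 - (k + 1) = m := by omega
  have hb := mul_genBinom_succ (p := p) (α + ((p - 1 : ℕ) : A)) (m := m) (by omega)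
  have hx := mul_inv_factorial_succ (p := p) x hk
  have hpA : (p : A) = 0 := by
    rw [← map_natCast (algebraMap (ZMod p) A)]; simp
  -- `m + 1` and `k + 1` add up to `p`, so they are opposite in `A`.
  have hmk : ((m + 1 : ℕ) : A) = -((k + 1 : ℕ) : A) := by
    rw [eq_neg_iff_add_eq_zero, ← Nat.cast_add, ← hpA]
    congr 1; omega
  have hfac : α + ((p - 1 : ℕ) : A) - m = α + (k + 1 : ℕ) := by
    have : ((p - 1 : ℕ) : A) = ((m + k + 1 : ℕ) : A) := by congr 1; omega
    rw [this]; push_cast; ring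
  have hunit : IsUnit ((k + 1 : ℕ) : A) := by
    rw [← map_natCast (algebraMap (ZMod p) A)]
    refine (IsUnit.mk0 _ ?_).map _
    rw [Ne, ZMod.natCast_eq_zero_iff]
    exact Nat.not_dvd_of_pos_of_lt k.succ_pos hk
  rw [hmk, hfac] at hb
  refine hunit.mul_left_cancel ?_
  rw [laguerreTerm, laguerreTerm, e1, e2]
  linear_combination (-x * (((k ! : ℕ) : ZMod p)⁻¹ • (-x) ^ k)) * hb -
    (genBinom (ZMod p) (α + ((p - 1 : ℕ) : A)) m * (α + (k + 1 : ℕ))) * hx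

theorem mul_laguerreTerm_last (α x : A) :
    x * laguerreTerm p α x (p - 1) = -x ^ p := by
  have hp := (Fact.out : p.Prime).pos
  have hs : (-1 : A) ^ (p - 1) = 1 := by
    have := ZMod.pow_card_sub_one_eq_one (p := p) (a := -1) (by simp)
    simpa using congrArg (algebraMap (ZMod p) A) this
  rw [laguerreTerm, ZMod.wilsons_lemma, neg_pow, hs, Nat.sub_self, genBinom]
  conv_rhs => rw [← Nat.sub_add_cancel hp, pow_succ']
  simp

theorem mul_laguerreTerm_zero (α x : A) :
    α * laguerreTerm p α x 0 = α - α ^ p := by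
  have hp := (Fact.out : p.Prime).pos
  rw [laguerreTerm, genBinom, natCast_pred_eq_neg_one, Nat.sub_zero, ZMod.wilsons_lemma,
    ← neg_sub, ← prod_range_sub_natCast p α]
  have hsplit : ∏ j ∈ Finset.range p, (α - (j : A)) =
      (∏ j ∈ Finset.range (p - 1), (α - ((j + 1 : ℕ) : A))) * α := by
    obtain ⟨q, hq⟩ : ∃ q, p = q + 1 := ⟨p - 1, by omega⟩
    rw [show p - 1 = q by omega, hq, Finset.prod_range_succ', Nat.cast_zero, sub_zero]
  have : ∏ j ∈ Finset.range (p - 1), (α + -1 - (j : A)) =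
      ∏ j ∈ Finset.range (p - 1), (α - ((j + 1 : ℕ) : A)) :=
    Finset.prod_congr rfl fun j _ => by push_cast; ring
  rw [this, hsplit]
  simp [mul_comm]

/-- The operator `x d/dx` multiplies the `k`-th term by `k`, so this is the differential equation
`x L' = (x - α) L + x^p + α - α^p` of `L = L_{p-1}^{(α)}` in characteristic `p`. -/
theorem sum_mul_laguerreTerm (α x : A) :
    ∑ k ∈ Finset.range p, (k : A) * laguerreTerm p α x k =
      (x - α) * laguerre (ZMod p) (p - 1) α x + x ^ p + α - α ^ p := by
  have hp := (Fact.out : p.Prime).pos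
  have hlast := mul_laguerreTerm_last (p := p) α x
  have hzero := mul_laguerreTerm_zero (p := p) α x
  rw [laguerre_eq_sum_laguerreTerm]
  obtain ⟨q, hq⟩ : ∃ q, p = q + 1 := ⟨p - 1, by omega⟩
  have hstep : ∑ k ∈ Finset.range q, x * laguerreTerm p α x k =
      ∑ k ∈ Finset.range q, (α + (k + 1 : ℕ)) * laguerreTerm p α x (k + 1) :=
    Finset.sum_congr rfl fun k hk =>
      mul_laguerreTerm α x (by have := Finset.mem_range.1 hk; omega)
  have e1 (f : ℕ → A) : ∑ k ∈ Finset.range p, f k = ∑ k ∈ Finset.range q, f k + f (p - 1) := by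
    rw [show p - 1 = q by omega, ← Finset.sum_range_succ, ← hq]
  have e2 (f : ℕ → A) : ∑ k ∈ Finset.range p, f k = ∑ k ∈ Finset.range q, f (k + 1) + f 0 := by
    rw [hq, Finset.sum_range_succ']
  simp only [add_mul, Finset.sum_add_distrib, ← Finset.mul_sum] at hstep
  have h1 := e1 (laguerreTerm p α x)
  have h2 := e2 (laguerreTerm p α x)
  rw [e2 fun k => (k : A) * laguerreTerm p α x k, Nat.cast_zero, zero_mul, add_zero]
  linear_combination -hstep - hlast + hzero - x * h1 + α * h2

theorem derivative_genBinom {K : Type*} [Field K] {a : K⟦X⟧} (ha : d⁄dX K a = 0) (m : ℕ) :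
    d⁄dX K (genBinom K a m) = 0 := by
  have h : d⁄dX K (∏ j ∈ Finset.range m, (a - (j : K⟦X⟧))) = 0 := by
    induction m with
    | zero => simp
    | succ m ih => simp [Finset.prod_range_succ, Derivation.leibniz, ih, ha]
  rw [genBinom, Derivation.map_smul, h, smul_zero]

theorem X_mul_derivative_laguerreTerm {α : (ZMod p)⟦X⟧} (hα : d⁄dX (ZMod p) α = 0) (k : ℕ) :
    X * d⁄dX (ZMod p) (laguerreTerm p α X k) = (k : (ZMod p)⟦X⟧) * laguerreTerm p α X k := by
  have h : d⁄dX (ZMod p) (genBinom (ZMod p) (α + ((p - 1 : ℕ) : (ZMod p)⟦X⟧)) (p - 1 - k)) = 0 :=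
    derivative_genBinom (by simp [hα]) _
  have hX : X * d⁄dX (ZMod p) ((-X : (ZMod p)⟦X⟧) ^ k) = (k : (ZMod p)⟦X⟧) * (-X) ^ k := by
    obtain _ | k := k
    · simp
    · rw [derivative_pow, map_neg, derivative_X, Nat.add_sub_cancel, pow_succ]
      ring
  rw [laguerreTerm, Derivation.leibniz, h, Derivation.map_smul, smul_zero, add_zero, smul_eq_mul,
    mul_left_comm, mul_smul_comm, hX, mul_left_comm (k : (ZMod p)⟦X⟧),
    mul_smul_comm, mul_smul_comm, mul_smul_comm]

theorem X_mul_derivative_laguerre {α : (ZMod p)⟦X⟧} (hα : d⁄dX (ZMod p) α = 0) :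
    X * d⁄dX (ZMod p) (laguerre (ZMod p) (p - 1) α X) =
      (X - α) * laguerre (ZMod p) (p - 1) α X + X ^ p + α - α ^ p := by
  rw [← sum_mul_laguerreTerm, laguerre_eq_sum_laguerreTerm, map_sum, Finset.mul_sum]
  exact Finset.sum_congr rfl fun k _ => X_mul_derivative_laguerreTerm hα k

/-! ### The Laguerre series and its comparison with the Artin–Hasse exponential -/

theorem frobeniusSum_eq_X_mul : frobeniusSum p = X * artinHasseLogDeriv (ZMod p) p - X := by
  have hp := (Fact.out : p.Prime).one_lt
  ext n
  rw [map_sub, coeff_X]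
  obtain _ | n := n
  · rw [coeff_zero_X_mul, frobeniusSum, coeff_mk, if_neg]
    · simp
    · rintro ⟨i, -, hi⟩
      exact (pow_ne_zero i (by omega)) hi.symm
  rw [coeff_succ_X_mul, frobeniusSum, artinHasseLogDeriv, coeff_mk, coeff_mk]
  obtain rfl | hn := eq_or_ne n 0
  · rw [if_neg, if_pos ⟨0, by simp⟩]
    · simp
    · rintro ⟨i, hi, h⟩
      exact (Nat.one_lt_pow (by omega) hp).ne h
  · rw [if_neg (show ¬ n + 1 = 1 by omega), sub_zero]
    congr 1
    refine propext ⟨fun ⟨i, _, h⟩ => ⟨i, h⟩, fun ⟨i, h⟩ => ⟨i, ?_, h⟩⟩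
    by_contra hi
    obtain rfl : i = 0 := by omega
    simp_all

/-- This is `α^p - α = X^p` for `α = -∑_{i ≥ 1} X^(p^i)`, which makes the inhomogeneous term of the
differential equation of `L_{p-1}^{(α)}` vanish. -/
theorem frobeniusSum_eq (hp : p ≠ 0) : frobeniusSum p = X ^ p + frobeniusSum p ^ p := by
  rw [← expand_card_eq_pow hp (frobeniusSum p), frobeniusSum_eq_X_mul, map_sub, map_mul,
    expand_X]
  conv_lhs => rw [artinHasseLogDeriv_eq _ hp]
  have : (X : (ZMod p)⟦X⟧) ^ p = X * X ^ (p - 1) := by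
    rw [← pow_succ', Nat.sub_add_cancel (Nat.pos_of_ne_zero hp)]
  rw [this]
  ring

theorem derivative_frobeniusSum : d⁄dX (ZMod p) (frobeniusSum p) = 0 := by
  rw [frobeniusSum_eq (Fact.out : p.Prime).ne_zero, map_add, derivative_pow, derivative_pow,
    natCast_self_eq_zero]
  simp

theorem derivative_laguerreSeries :
    d⁄dX (ZMod p) (laguerreSeries p) = artinHasseLogDeriv (ZMod p) p * laguerreSeries p := by
  have hα : d⁄dX (ZMod p) (-frobeniusSum p) = 0 := by
    rw [map_neg, derivative_frobeniusSum, neg_zero]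
  have hF := frobeniusSum_eq (p := p) (Fact.out : p.Prime).ne_zero
  have hneg : (-frobeniusSum p) ^ p = -frobeniusSum p ^ p := by
    rw [← expand_card_eq_pow (Fact.out : p.Prime).ne_zero,
      ← expand_card_eq_pow (Fact.out : p.Prime).ne_zero, map_neg]
  have h := X_mul_derivative_laguerre hα
  refine mul_left_cancel₀ (X_ne_zero (R := ZMod p)) ?_
  rw [laguerreSeries, h, hneg]
  have hF' := frobeniusSum_eq_X_mul (p := p)
  linear_combination -hF + laguerre (ZMod p) (p - 1) (-frobeniusSum p) X * hF'

theorem constantCoeff_laguerreSeries : constantCoeff (laguerreSeries p) = 1 := by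
  have hp := (Fact.out : p.Prime).pos
  have hα : constantCoeff (-frobeniusSum p + ((p - 1 : ℕ) : (ZMod p)⟦X⟧)) = -1 := by
    rw [frobeniusSum_eq_X_mul, natCast_pred_eq_neg_one]
    simp
  have hprod : ∏ j ∈ Finset.range (p - 1), (-1 - (j : ZMod p)) = (((p - 1)! : ℕ) : ZMod p) := by
    have h (j : ℕ) : -1 - (j : ZMod p) = -1 * ((j + 1 : ℕ) : ZMod p) := by push_cast; ring
    rw [Finset.prod_congr rfl fun j _ => h j, Finset.prod_mul_distrib, Finset.prod_const,
      Finset.card_range, ZMod.pow_card_sub_one_eq_one (by simp), one_mul, ← Nat.cast_prod,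
      Finset.prod_range_add_one_eq_factorial]
  rw [laguerreSeries, laguerre_eq_sum_laguerreTerm, map_sum, Finset.sum_eq_single_of_mem 0
    (Finset.mem_range.2 hp)]
  · have hc (c : ZMod p) (f : (ZMod p)⟦X⟧) : constantCoeff (c • f) = c * constantCoeff f := by
      rw [smul_eq_C_mul, map_mul, constantCoeff_C]
    simp only [laguerreTerm, genBinom, map_mul, hc, map_prod, map_sub, hα, map_natCast]
    rw [Nat.sub_zero, hprod, inv_mul_cancel₀ (factorial_ne_zero_zmod (Nat.sub_lt hp one_pos))]
    simp
  · intro k _ hk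
    rw [laguerreTerm, smul_eq_C_mul]
    simp [hk]

theorem exists_eq_expand_of_derivative_eq_zero (hp : p ≠ 0) {f : (ZMod p)⟦X⟧}
    (hf : d⁄dX (ZMod p) f = 0) : ∃ g : (ZMod p)⟦X⟧, f = g.expand p hp := by
  refine ⟨mk fun n => coeff (p * n) f, ?_⟩
  ext n
  rw [coeff_expand, coeff_mk]
  split_ifs with h
  · rw [Nat.mul_div_cancel' h]
  · obtain _ | n := n
    · simp at h
    · have h1 := congrArg (coeff n) hf
      rw [coeff_derivative, map_zero, mul_eq_zero] at h1
      refine h1.resolve_right fun h2 => h ?_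
      rw [← ZMod.natCast_eq_zero_iff]
      exact_mod_cast h2

end Laguerre

theorem proposition3 (p : ℕ) [Fact p.Prime] :
    (∀ n : ℕ, ¬ p ∣ (PowerSeries.coeff n (artinHasseExp p)).den) ∧
    ∃ G : PowerSeries (ZMod p), PowerSeries.constantCoeff G = 1 ∧
      laguerreSeries p =
        reduceMod p (artinHasseExp p) * G.subst (PowerSeries.X ^ p : PowerSeries (ZMod p)) := by
  have hp : p ≠ 0 := (Fact.out : p.Prime).ne_zero
  refine ⟨fun n => mem_pIntegral_iff_not_dvd.1 (coeff_artinHasseExp_mem_pIntegral n), ?_⟩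
  set e := reduceMod p (artinHasseExp p)
  have he0 : constantCoeff e = 1 := constantCoeff_reduceMod_artinHasseExp
  have he1 : constantCoeff e ≠ 0 := by rw [he0]; exact one_ne_zero
  have hd : d⁄dX (ZMod p) (laguerreSeries p * e⁻¹) = 0 := by
    rw [Derivation.leibniz, derivative_inv', derivative_laguerreSeries,
      derivative_reduceMod_artinHasseExp]
    simp only [smul_eq_mul]
    linear_combination (-laguerreSeries p * artinHasseLogDeriv (ZMod p) p * e⁻¹) *
      PowerSeries.mul_inv_cancel e he1
  obtain ⟨G, hG⟩ := exists_eq_expand_of_derivative_eq_zero hp hd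
  refine ⟨G, ?_, ?_⟩
  · rw [← constantCoeff_expand p hp, ← hG, map_mul, constantCoeff_laguerreSeries,
      constantCoeff_inv, he0, inv_one, one_mul]
  · rw [← expand_apply p hp, ← hG, mul_left_comm, PowerSeries.mul_inv_cancel e he1, mul_one]
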